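/- For $n\ge 2$ let $\mathbb{S}^n$ be the space of real symmetric $n\times n$ matrices, let $\mathbb{L}^n=\{x\in\mathbb{R}^n \mid x_1\ge\sqrt{x_2^2+\cdots+x_n^2}\}$ be the second-order cone, and let $$\mathcal{COP}(\mathbb{L}^n)=\{A\in\mathbb{S}^n \mid x^\top A x\ge 0 \text{ for all } x\in\mathbb{L}^n\}$$ be the copositive cone over $\mathbb{L}^n$. A face of a closed convex cone $\mathbb{K}$ is a nonempty convex subcone $\mathbb{F}\subseteq\mathbb{K}$ such that $a,b\in\mathbb{K}$ and $a+b\in\mathbb{F}$ imply $a,b\in\mathbb{F}$. A cone is polyhedral if it is the intersection of finitely many closed half-spaces $\{x\mid \varphi(x)\ge 0\}$ with $\varphi$ a linear functional. The distance to polyhedrality $\ell_{\rm poly}(\mathbb{K})$ of $\mathbb{K}$ is the maximum length $l$ of a chain $\mathbb{F}_l\subsetneq\cdots\subsetneq\mathbb{F}_1$ of faces of $\mathbb{K}$ whose smallest member $\mathbb{F}_l$ is not polyhedral. Then $$\ell_{\rm poly}(\mathcal{COP}(\mathbb{L}^n))=\begin{cases}1 & (n=2),\\ n & (n\ge 3).\end{cases}$$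 -/

import Mathlib

open scoped Matrix

noncomputable section

namespace CopositiveSOC

/-- The space `𝕊ⁿ` of real symmetric `n × n` matrices. -/
def Sym (n : ℕ) : Submodule ℝ (Matrix (Fin n) (Fin n) ℝ) where
  carrier := {A | A.IsSymm}
  zero_mem' := Matrix.isSymm_zero
  add_mem' := fun hA hB => Matrix.IsSymm.add hA hB
  smul_mem' := fun c _ hA => Matrix.IsSymm.smul hA c

/-- The second-order cone `𝕃ⁿ = {x ∈ ℝⁿ | x₁ ≥ √(x₂² + ⋯ + xₙ²)}`; the first coordinate has
index `0`. -/
def secondOrderCone (n : ℕ) [NeZero n] : Set (Fin n → ℝ) :=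
  {x | √(∑ i ∈ Finset.univ.erase (0 : Fin n), x i ^ 2) ≤ x 0}

/-- The copositive cone `COP(K) = {A ∈ 𝕊ⁿ | xᵀ A x ≥ 0 for all x ∈ K}`. -/
def COP {n : ℕ} (K : Set (Fin n → ℝ)) : PointedCone ℝ (Sym n) where
  carrier := {A | ∀ x ∈ K, 0 ≤ x ⬝ᵥ ((A : Matrix (Fin n) (Fin n) ℝ) *ᵥ x)}
  zero_mem' := by
    intro x _
    simp
  add_mem' := by
    intro A B hA hB x hx
    have h := add_nonneg (hA x hx) (hB x hx)
    simpa [Matrix.add_mulVec, dotProduct_add] using h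
  smul_mem' := by
    intro c A hA x hx
    have h := mul_nonneg c.2 (hA x hx)
    have e : ((c • A : Sym n) : Matrix (Fin n) (Fin n) ℝ)
        = (c : ℝ) • (A : Matrix (Fin n) (Fin n) ℝ) := rfl
    rw [e, Matrix.smul_mulVec, dotProduct_smul]
    exact h

variable {E : Type*} [AddCommGroup E] [Module ℝ E]

/-- A cone in a finite-dimensional real vector space is polyhedral if it is the intersection of
finitely many half-spaces `{x | 0 ≤ φ x}`, with `φ` a linear functional. -/
def IsPolyhedral (C : PointedCone ℝ E) : Prop :=
  C.DualFG (LinearMap.id : Module.Dual ℝ E →ₗ[ℝ] Module.Dual ℝ E)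

/-- `F 0 ⊋ F 1 ⊋ ⋯ ⊋ F k` is a chain of faces of `C` (of length `k + 1`) whose smallest member
`F k` is not polyhedral. -/
structure IsNonpolyhedralChain (C : PointedCone ℝ E) {k : ℕ}
    (F : Fin (k + 1) → PointedCone ℝ E) : Prop where
  strictAnti : StrictAnti F
  isFaceOf : ∀ i, (F i).IsFaceOf C
  not_isPolyhedral : ¬ IsPolyhedral (F (Fin.last k))

/-- The distance to polyhedrality of `C`: the maximum length (number of faces) of a chain of faces
of `C` whose smallest member is not polyhedral. It is `0` if there is no such chain and `⊤` if
their lengths are unbounded; any other value is attained, being a finite supremum of natural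
numbers. -/
def distToPolyhedrality (C : PointedCone ℝ E) : ℕ∞ :=
  sSup {l : ℕ∞ | ∃ (k : ℕ) (F : Fin (k + 1) → PointedCone ℝ E),
    IsNonpolyhedralChain C F ∧ l = (k : ℕ∞) + 1}

end CopositiveSOC

end

/-! Write J for the Lorentz form. Up to sign, 𝕃ⁿ is where J is nonnegative, so by the S-lemma the
copositive matrices are exactly P + tJ with P positive semidefinite and t ≥ 0
(`mem_COP_secondOrderCone_iff`). Splitting P into rank-one matrices v vᵀ, a face F is determined by
the subspace V of all v with v vᵀ in F and by whether J lies in F (`le_of_dyadSpace_le`).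

Hence the rank dim V + [J ∈ F], at most n + 1, drops strictly along a chain of faces. If dim V ≤ 1,
then F is generated by at most two independent matrices and is polyhedral; so nonpolyhedral faces
have rank at least 2, and a chain has at most n members (`length_add_one_le`).

For n ≥ 3 every rank from n + 1 down to 2 is realized. Positive semidefinite matrices annihilating a
set W that contains a nonzero J-null vector form a face, with or without multiples of J added.
Enlarging W to leave a two-dimensional V, then dropping J, ends in a copy of the 2 × 2 semidefinite
cone, which is not polyhedral. For n = 2, dim V = 2 already forces F to be the whole cone, so the
only chain is trivial. -/

noncomputable section

namespace CopositiveSOC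

/-! ### Polyhedral cones -/

section Polyhedral

variable {E : Type*} [AddCommGroup E] [Module ℝ E]

/-- A cone that contains a parabola `p + s • q + s ^ 2 • r`, for infinitely many parameters `s`, in
such a way that no point of the parabola may be moved in the direction `-r`, is not polyhedral. -/
theorem not_isPolyhedral_of_parabola {C : PointedCone ℝ E} {p q r : E} {S : Set ℝ}
    (hS : S.Infinite) (hmem : ∀ s ∈ S, p + s • q + s ^ 2 • r ∈ C)
    (hnot : ∀ s ∈ S, ∀ ε : ℝ, 0 < ε → p + s • q + s ^ 2 • r - ε • r ∉ C) :
    ¬ IsPolyhedral C := by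
  rintro ⟨Φ, hΦ⟩
  have hC : ∀ x, x ∈ C ↔ ∀ φ ∈ Φ, 0 ≤ φ x := by
    intro x
    rw [← hΦ]
    rfl
  -- Some constraint with φ r ≠ 0 must be tight at s, else a small move along -r stays in `C`. Each
  -- such φ is tight at only finitely many s, being a nonzero quadratic polynomial in s, and Φ is
  -- finite.
  have key : ∀ s ∈ S, ∃ φ ∈ Φ, φ r ≠ 0 ∧ φ p + s * φ q + s ^ 2 * φ r = 0 := by
    intro s hs
    by_contra! hcon
    have hev : ∀ᶠ ε : ℝ in nhdsWithin 0 (Set.Ioi 0),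
        ∀ φ ∈ Φ, 0 ≤ φ (p + s • q + s ^ 2 • r - ε • r) := by
      rw [Filter.eventually_all_finset]
      intro φ hφ
      have h0 := (hC _).1 (hmem s hs) φ hφ
      simp only [map_sub, map_add, map_smul, smul_eq_mul] at h0 ⊢
      by_cases hr : φ r = 0
      · exact Filter.Eventually.of_forall fun ε => by simpa [hr] using h0
      · have hpos := lt_of_le_of_ne h0 (Ne.symm (hcon φ hφ hr))
        have hcont : Filter.Tendsto (fun ε : ℝ => φ p + s * φ q + s ^ 2 * φ r - ε * φ r)
            (nhdsWithin 0 (Set.Ioi 0)) (nhds (φ p + s * φ q + s ^ 2 * φ r - 0 * φ r)) :=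
          (Continuous.tendsto (by fun_prop) 0).mono_left nhdsWithin_le_nhds
        rw [zero_mul, sub_zero] at hcont
        exact (hcont.eventually (lt_mem_nhds hpos)).mono fun _ h => h.le
    obtain ⟨ε, hε, hpos⟩ := (hev.and self_mem_nhdsWithin).exists
    exact hnot s hs ε hpos ((hC _).2 hε)
  refine hS (Set.Finite.subset (Set.Finite.biUnion Φ.finite_toSet
    (t := fun φ => {s : ℝ | φ r ≠ 0 ∧ φ p + s * φ q + s ^ 2 * φ r = 0}) ?_) ?_)
  · intro φ _
    by_cases hr : φ r = 0
    · simp [hr]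
    · let P : Polynomial ℝ := Polynomial.C (φ p) + Polynomial.C (φ q) * Polynomial.X
        + Polynomial.C (φ r) * Polynomial.X ^ 2
      have hP : P ≠ 0 := by
        intro h
        have h2 : P.coeff 2 = 0 := by rw [h, Polynomial.coeff_zero]
        apply hr
        simpa [P, Polynomial.coeff_C, Polynomial.coeff_X] using h2
      refine (Polynomial.finite_setOfPred_isRoot hP).subset ?_
      rintro s ⟨-, hs⟩
      simp only [Set.mem_ofPred_eq, Polynomial.IsRoot, P, Polynomial.eval_add, Polynomial.eval_mul,
        Polynomial.eval_C, Polynomial.eval_X, Polynomial.eval_pow]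
      linarith
  · intro s hs
    obtain ⟨φ, hφ, h⟩ := key s hs
    exact Set.mem_biUnion (show φ ∈ (Φ : Set _) from hφ) h

/-- A cone generated by a finite linearly independent family is polyhedral. -/
theorem isPolyhedral_of_linearIndependent [FiniteDimensional ℝ E] {ι : Type*} [Fintype ι]
    {g : ι → E} (hg : LinearIndependent ℝ g) {C : PointedCone ℝ E}
    (hC : ∀ x, x ∈ C ↔ ∃ c : ι → ℝ, (∀ i, 0 ≤ c i) ∧ x = ∑ i, c i • g i) :
    IsPolyhedral C := by
  obtain ⟨f, hf⟩ := (Fintype.linearCombination ℝ g).exists_leftInverse_of_injective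
    (LinearMap.ker_eq_bot.2 (linearIndependent_iff_injective_fintypeLinearCombination.1 hg))
  have hf' : ∀ c, f (∑ i, c i • g i) = c := fun c => by
    simpa [Fintype.linearCombination_apply] using LinearMap.congr_fun hf c
  let b := Module.finBasis ℝ E
  let d : E →ₗ[ℝ] E := LinearMap.id - Fintype.linearCombination ℝ g ∘ₗ f
  -- The first functionals make the coefficients nonnegative; the opposite pairs force `d x = 0`,
  -- that is, x lies in the span of `g`.
  let Φ : Set (Module.Dual ℝ E) := Set.range (fun i => LinearMap.proj i ∘ₗ f) ∪
    (Set.range (fun j => b.coord j ∘ₗ d) ∪ Set.range (fun j => -(b.coord j ∘ₗ d)))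
  have hΦ : Φ.Finite :=
    (Set.finite_range _).union ((Set.finite_range _).union (Set.finite_range _))
  have : C = PointedCone.dual (LinearMap.id : Module.Dual ℝ E →ₗ[ℝ] Module.Dual ℝ E) Φ := by
    ext x
    rw [hC, PointedCone.mem_dual]
    constructor
    · rintro ⟨c, hc, hx⟩ φ hφ
      have hfx : f x = c := by rw [hx, hf']
      have hd : d x = 0 := by
        simp [d, hfx, Fintype.linearCombination_apply, ← hx]
      rcases hφ with ⟨i, rfl⟩ | ⟨j, rfl⟩ | ⟨j, rfl⟩
      · simpa [hfx] using hc i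
      · simp [hd]
      · simp [hd]
    · intro h
      refine ⟨f x, fun i => h (Or.inl ⟨i, rfl⟩), ?_⟩
      have hd : d x = 0 := by
        refine b.ext_elem fun j => ?_
        have h1 := h (Or.inr (Or.inl ⟨j, rfl⟩))
        have h2 := h (Or.inr (Or.inr ⟨j, rfl⟩))
        simp only [LinearMap.id_coe, id_eq, LinearMap.neg_apply, LinearMap.comp_apply,
          Module.Basis.coord_apply] at h1 h2
        rw [map_zero, Finsupp.zero_apply]
        linarith
      simpa [d, sub_eq_zero, Fintype.linearCombination_apply] using hd
  rw [this]
  exact PointedCone.DualFG.dual_of_finite _ hΦ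

theorem smul_mem_iff_of_pos {F : PointedCone ℝ E} {x : E} {t : ℝ} (ht : 0 < t) : t • x ∈ F ↔ x ∈ F := by
  refine ⟨fun h => ?_, fun h => F.smul_mem ht.le h⟩
  have := F.smul_mem (inv_nonneg.2 ht.le) h
  rwa [smul_smul, inv_mul_cancel₀ ht.ne', one_smul] at this

end Polyhedral

/-! ### Quadratic forms of symmetric matrices -/

section Quadratic

variable {n : ℕ}

/-- The value at `x` of the quadratic form of a symmetric matrix. -/
def qf (A : Sym n) (x : Fin n → ℝ) : ℝ := x ⬝ᵥ ((A : Matrix (Fin n) (Fin n) ℝ) *ᵥ x)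

theorem qf_add (A B : Sym n) (x : Fin n → ℝ) : qf (A + B) x = qf A x + qf B x := by
  simp [qf, Matrix.add_mulVec, dotProduct_add]

theorem qf_sub (A B : Sym n) (x : Fin n → ℝ) : qf (A - B) x = qf A x - qf B x := by
  simp [qf, Matrix.sub_mulVec, dotProduct_sub]

theorem qf_smul (c : ℝ) (A : Sym n) (x : Fin n → ℝ) : qf (c • A) x = c * qf A x := by
  simp [qf, Matrix.smul_mulVec, dotProduct_smul]

theorem qf_neg_right (A : Sym n) (x : Fin n → ℝ) : qf A (-x) = qf A x := by
  simp [qf, Matrix.mulVec_neg]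

theorem qf_eq_zero_of_mulVec (A : Sym n) {x : Fin n → ℝ}
    (h : (A : Matrix (Fin n) (Fin n) ℝ) *ᵥ x = 0) : qf A x = 0 := by
  rw [qf, h, dotProduct_zero]

theorem qf_smul_add (A : Sym n) (s : ℝ) (x y : Fin n → ℝ) :
    qf A (s • x + y) = s ^ 2 * qf A x
      + 2 * s * (x ⬝ᵥ ((A : Matrix (Fin n) (Fin n) ℝ) *ᵥ y)) + qf A y := by
  have hA : (A : Matrix (Fin n) (Fin n) ℝ)ᵀ = A := A.2
  have hsymm : y ⬝ᵥ ((A : Matrix (Fin n) (Fin n) ℝ) *ᵥ x)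
      = x ⬝ᵥ ((A : Matrix (Fin n) (Fin n) ℝ) *ᵥ y) := by
    rw [Matrix.dotProduct_mulVec, ← Matrix.mulVec_transpose, hA, dotProduct_comm]
  simp only [qf, Matrix.mulVec_add, Matrix.mulVec_smul, dotProduct_add, add_dotProduct,
    smul_dotProduct, dotProduct_smul, smul_eq_mul, hsymm]
  ring

theorem posSemidef_iff_qf (A : Sym n) :
    (A : Matrix (Fin n) (Fin n) ℝ).PosSemidef ↔ ∀ x, 0 ≤ qf A x := by
  rw [Matrix.posSemidef_iff_dotProduct_mulVec]
  refine ⟨fun h x => by simpa [qf] using h.2 x, fun h => ⟨?_, fun x => by simpa [qf] using h x⟩⟩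
  rw [Matrix.IsHermitian, Matrix.conjTranspose_eq_transpose_of_trivial]
  exact A.2

theorem mulVec_eq_zero_of_qf {A : Sym n} (hA : ∀ x, 0 ≤ qf A x) {x : Fin n → ℝ}
    (h : qf A x = 0) : (A : Matrix (Fin n) (Fin n) ℝ) *ᵥ x = 0 := by
  refine (((posSemidef_iff_qf A).2 hA).dotProduct_mulVec_zero_iff x).1 ?_
  simpa [qf] using h

/-- The rank-one matrix `v vᵀ`. -/
def dyad (v : Fin n → ℝ) : Sym n :=
  ⟨Matrix.vecMulVec v v, by
    show (Matrix.vecMulVec v v)ᵀ = _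
    rw [Matrix.transpose_vecMulVec]⟩

theorem dyad_mulVec (v x : Fin n → ℝ) :
    (dyad v : Matrix (Fin n) (Fin n) ℝ) *ᵥ x = (v ⬝ᵥ x) • v := by
  rw [dyad, Matrix.vecMulVec_mulVec]
  ext i
  simp [mul_comm]

theorem qf_dyad (v x : Fin n → ℝ) : qf (dyad v) x = (v ⬝ᵥ x) ^ 2 := by
  rw [qf, dyad_mulVec, dotProduct_smul, dotProduct_comm x v, smul_eq_mul, sq]

theorem dyad_apply (v : Fin n → ℝ) (i j : Fin n) :
    (dyad v : Matrix (Fin n) (Fin n) ℝ) i j = v i * v j := rfl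

theorem dyad_smul (c : ℝ) (v : Fin n → ℝ) : dyad (c • v) = c ^ 2 • dyad v := by
  ext i j
  simp [dyad_apply]
  ring

/-- The parallelogram identity, which makes `dyadSpace` closed under addition. -/
theorem dyad_add_add_dyad_sub (u v : Fin n → ℝ) :
    dyad (u + v) + dyad (u - v) = (2 : ℝ) • (dyad u + dyad v) := by
  ext i j
  simp [dyad_apply]
  ring

/-- Supplies the parabolas for `not_isPolyhedral_of_parabola`. -/
theorem dyad_add_smul (a b : Fin n → ℝ) (s : ℝ) :
    dyad (a + s • b) = dyad a + s • (dyad (a + b) - dyad a - dyad b) + s ^ 2 • dyad b := by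
  ext i j
  simp [dyad_apply]
  ring

theorem dyad_zero : dyad (0 : Fin n → ℝ) = 0 := by
  ext i j
  simp [dyad_apply]

/-- Every positive semidefinite matrix is a sum of matrices of rank one. -/
theorem exists_eq_sum_dyad {A : Sym n} (hA : ∀ x, 0 ≤ qf A x) :
    ∃ (m : ℕ) (v : Fin m → Fin n → ℝ), A = ∑ i, dyad (v i) := by
  obtain ⟨m, v, hv⟩ := Matrix.posSemidef_iff_eq_sum_vecMulVec.1 ((posSemidef_iff_qf A).2 hA)
  refine ⟨m, v, Subtype.ext ?_⟩
  rw [hv, AddSubmonoidClass.coe_finsetSum]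
  simp [dyad]

/-- The homogeneous S-lemma. -/
theorem exists_forall_mul_qf_le {A B : Sym n} (h : ∀ x, 0 ≤ qf B x → 0 ≤ qf A x)
    (hB : ∃ x, 0 < qf B x) : ∃ t : ℝ, 0 ≤ t ∧ ∀ x, t * qf B x ≤ qf A x := by
  -- On the line s • x + y the form B vanishes at two parameters of opposite sign, where A is
  -- nonnegative. The combination of these two inequalities that cancels the cross term is the
  -- claim.
  have key : ∀ x y, 0 < qf B x → qf B y < 0 → qf B y * qf A x ≤ qf B x * qf A y := by
    intro x y hx hy
    set p := qf B x
    set q := qf B y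
    set j := x ⬝ᵥ ((B : Matrix (Fin n) (Fin n) ℝ) *ᵥ y)
    set a := x ⬝ᵥ ((A : Matrix (Fin n) (Fin n) ℝ) *ᵥ y)
    have hpq : 0 < -(p * q) := by nlinarith
    set r := √(j ^ 2 - p * q)
    have hr : r ^ 2 = j ^ 2 - p * q := Real.sq_sqrt (by nlinarith [sq_nonneg j])
    have hr0 : 0 < r := Real.sqrt_pos.2 (by nlinarith [sq_nonneg j])
    have hjr := abs_lt.1 (abs_lt_of_sq_lt_sq (by linarith : j ^ 2 < r ^ 2) hr0.le)
    have ev : ∀ s, p * s ^ 2 + 2 * j * s + q = 0 → 0 ≤ s ^ 2 * qf A x + 2 * s * a + qf A y := by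
      intro s hs
      rw [← qf_smul_add]
      refine h _ ?_
      rw [qf_smul_add]
      exact le_of_eq (by linarith)
    set s₁ := (-j + r) / p
    set s₂ := (-j - r) / p
    have e₁ : p * s₁ = -j + r := mul_div_cancel₀ _ hx.ne'
    have e₂ : p * s₂ = -j - r := mul_div_cancel₀ _ hx.ne'
    have h₁ : 0 < s₁ := div_pos (by linarith) hx
    have h₂ : s₂ < 0 := div_neg_of_neg_of_pos (by linarith) hx
    have hprod : p * (s₁ * s₂) = q := by
      have : p * (p * (s₁ * s₂)) = p * q := by
        linear_combination (p * s₂) * e₁ + (-j + r) * e₂ - hr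
      exact mul_left_cancel₀ hx.ne' this
    have i₁ := ev s₁ (by
      have : p * (p * s₁ ^ 2 + 2 * j * s₁ + q) = 0 := by
        linear_combination (p * s₁ + j + r) * e₁ + hr
      exact (mul_eq_zero.1 this).resolve_left hx.ne')
    have i₂ := ev s₂ (by
      have : p * (p * s₂ ^ 2 + 2 * j * s₂ + q) = 0 := by
        linear_combination (p * s₂ + j - r) * e₂ + hr
      exact (mul_eq_zero.1 this).resolve_left hx.ne')
    have i₃ : 0 ≤ (s₁ - s₂) * (qf A y - s₁ * s₂ * qf A x) := by
      nlinarith [mul_nonneg h₁.le i₂, mul_nonneg (neg_nonneg.2 h₂.le) i₁]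
    have i₄ := nonneg_of_mul_nonneg_right i₃ (by linarith)
    have i₅ := mul_nonneg hx.le i₄
    rw [mul_sub, ← mul_assoc, hprod] at i₅
    linarith
  obtain ⟨x₀, hx₀⟩ := hB
  set T : Set ℝ := {t | ∃ x, 0 < qf B x ∧ t = qf A x / qf B x}
  have hT : T.Nonempty := ⟨_, x₀, hx₀, rfl⟩
  have hT0 : ∀ t ∈ T, 0 ≤ t := by
    rintro _ ⟨x, hx, rfl⟩
    exact div_nonneg (h x hx.le) hx.le
  -- By `key`, every ratio A/B where B < 0 is at most every ratio where B > 0; the infimum of the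
  -- latter separates them.
  refine ⟨sInf T, Real.sInf_nonneg hT0, fun x => ?_⟩
  rcases lt_trichotomy (qf B x) 0 with hx | hx | hx
  · have : qf A x / qf B x ≤ sInf T := by
      refine le_csInf hT ?_
      rintro _ ⟨y, hy, rfl⟩
      rw [le_div_iff₀ hy, div_mul_eq_mul_div, div_le_iff_of_neg hx]
      linarith [key y x hy hx]
    exact (div_le_iff_of_neg hx).1 this
  · rw [hx, mul_zero]
    exact h x hx.ge
  · exact (le_div_iff₀ hx).1 (csInf_le ⟨0, hT0⟩ ⟨x, hx, rfl⟩)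

theorem mem_COP_iff_qf {A : Sym n} {K : Set (Fin n → ℝ)} : A ∈ COP K ↔ ∀ x ∈ K, 0 ≤ qf A x :=
  Iff.rfl

theorem mem_COP_of_qf_nonneg {A : Sym n} (hA : ∀ x, 0 ≤ qf A x) {K : Set (Fin n → ℝ)} :
    A ∈ COP K := fun x _ => hA x

theorem dyad_mem_COP (v : Fin n → ℝ) {K : Set (Fin n → ℝ)} : dyad v ∈ COP K :=
  mem_COP_of_qf_nonneg fun x => by rw [qf_dyad]; positivity

end Quadratic

/-! ### The Lorentz form and the copositive cone over the second-order cone -/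

section Lorentz

variable {n : ℕ} [NeZero n]

/-- The matrix `diag(1, -1, …, -1)` of the Lorentz form. -/
def lorentz (n : ℕ) [NeZero n] : Sym n :=
  ⟨Matrix.diagonal fun i => if i = 0 then 1 else -1, Matrix.isSymm_diagonal _⟩

theorem lorentz_mulVec (x : Fin n → ℝ) (i : Fin n) :
    ((lorentz n : Matrix (Fin n) (Fin n) ℝ) *ᵥ x) i = if i = 0 then x i else -x i := by
  rw [lorentz, Matrix.mulVec_diagonal]
  split_ifs <;> simp

theorem qf_lorentz (x : Fin n → ℝ) :
    qf (lorentz n) x = x 0 ^ 2 - ∑ i ∈ Finset.univ.erase (0 : Fin n), x i ^ 2 := by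
  rw [qf, dotProduct, ← Finset.add_sum_erase _ _ (Finset.mem_univ (0 : Fin n)), lorentz_mulVec,
    if_pos rfl, sub_eq_add_neg, ← Finset.sum_neg_distrib, sq]
  congr 1
  refine Finset.sum_congr rfl fun i hi => ?_
  rw [lorentz_mulVec, if_neg (Finset.ne_of_mem_erase hi)]
  ring

theorem qf_lorentz_nonneg {x : Fin n → ℝ} (hx : x ∈ secondOrderCone n) :
    0 ≤ qf (lorentz n) x := by
  rw [qf_lorentz, sub_nonneg]
  exact (Real.sqrt_le_left ((Real.sqrt_nonneg _).trans hx)).1 hx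

theorem mem_or_neg_mem_secondOrderCone {x : Fin n → ℝ} (hx : 0 ≤ qf (lorentz n) x) :
    x ∈ secondOrderCone n ∨ -x ∈ secondOrderCone n := by
  rw [qf_lorentz, sub_nonneg] at hx
  have h := Real.sqrt_le_sqrt hx
  rw [Real.sqrt_sq_eq_abs] at h
  rcases le_total 0 (x 0) with h0 | h0
  · exact Or.inl (by rwa [abs_of_nonneg h0] at h)
  · refine Or.inr ?_
    rw [abs_of_nonpos h0] at h
    simpa [secondOrderCone] using h

theorem qf_lorentz_single_zero : qf (lorentz n) (Pi.single 0 1) = 1 := by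
  rw [qf, single_one_dotProduct, lorentz_mulVec]
  simp

/-- A matrix is copositive over the second-order cone if and only if it is the sum of a positive
semidefinite matrix and a nonnegative multiple of the Lorentz form. -/
theorem mem_COP_secondOrderCone_iff {A : Sym n} :
    A ∈ COP (secondOrderCone n) ↔ ∃ t : ℝ, 0 ≤ t ∧ ∀ x, 0 ≤ qf (A - t • lorentz n) x := by
  rw [mem_COP_iff_qf]
  constructor
  · intro h
    obtain ⟨t, ht, h'⟩ := exists_forall_mul_qf_le (A := A) (B := lorentz n)
      (fun x hx => by
        rcases mem_or_neg_mem_secondOrderCone hx with h0 | h0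
        · exact h x h0
        · rw [← qf_neg_right]
          exact h _ h0) ⟨Pi.single 0 1, by rw [qf_lorentz_single_zero]; exact one_pos⟩
    refine ⟨t, ht, fun x => ?_⟩
    rw [qf_sub, qf_smul, sub_nonneg]
    exact h' x
  · rintro ⟨t, ht, h⟩ x hx
    have h1 := h x
    rw [qf_sub, qf_smul, sub_nonneg] at h1
    exact (mul_nonneg ht (qf_lorentz_nonneg hx)).trans h1

theorem lorentz_mem_COP : lorentz n ∈ COP (secondOrderCone n) :=
  fun _ hx => qf_lorentz_nonneg hx

/-- A nonzero rank-one matrix is linearly independent of the Lorentz form. -/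
theorem linearIndependent_dyad_lorentz (hn : 1 < n) {v : Fin n → ℝ} (hv : v ≠ 0) :
    LinearIndependent ℝ ![dyad v, lorentz n] := by
  rw [LinearIndependent.pair_iff]
  intro a b hab
  have hij : ∀ i j, a * (v i * v j)
      + b * (lorentz n : Matrix (Fin n) (Fin n) ℝ) i j = 0 := fun i j => by
    simpa [dyad_apply] using congrArg (fun M : Sym n => (M : Matrix (Fin n) (Fin n) ℝ) i j) hab
  have h10 : (⟨1, hn⟩ : Fin n) ≠ 0 := by
    intro h
    simpa using congrArg Fin.val h
  have h0 := hij 0 0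
  have h1 := hij ⟨1, hn⟩ ⟨1, hn⟩
  simp only [lorentz, Matrix.diagonal_apply_eq, if_true, if_neg h10] at h0 h1
  -- J has diagonal entries 1 and -1 while those of v vᵀ are nonnegative, so b would have both
  -- signs.
  have hb : b = 0 := by
    rcases le_total 0 a with ha | ha
    · nlinarith [mul_nonneg ha (mul_self_nonneg (v 0)),
        mul_nonneg ha (mul_self_nonneg (v ⟨1, hn⟩))]
    · nlinarith [mul_nonneg (neg_nonneg.2 ha) (mul_self_nonneg (v 0)),
        mul_nonneg (neg_nonneg.2 ha) (mul_self_nonneg (v ⟨1, hn⟩))]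
  obtain ⟨i, hi⟩ := Function.ne_iff.1 hv
  have := hij i i
  rw [hb, zero_mul, add_zero, mul_eq_zero, mul_self_eq_zero] at this
  exact ⟨this.resolve_right hi, hb⟩

end Lorentz

/-! ### The rank of a face -/

section Faces

variable {n : ℕ} {F G : PointedCone ℝ (Sym n)}

/-- The vectors `v` with `v vᵀ` in a given face of the copositive cone form a subspace. -/
def dyadSpace {K : Set (Fin n → ℝ)} (hF : F.IsFaceOf (COP K)) : Submodule ℝ (Fin n → ℝ) where
  carrier := {v | dyad v ∈ F}
  zero_mem' := by
    show dyad 0 ∈ F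
    rw [dyad_zero]
    exact F.zero_mem
  add_mem' := by
    intro u v hu hv
    refine hF.mem_of_add_mem_left (dyad_mem_COP _) (dyad_mem_COP (u - v)) ?_
    rw [dyad_add_add_dyad_sub]
    exact F.smul_mem zero_le_two (F.add_mem hu hv)
  smul_mem' := by
    intro c v hv
    show dyad (c • v) ∈ F
    rw [dyad_smul]
    exact F.smul_mem (sq_nonneg c) hv

theorem mem_dyadSpace {K : Set (Fin n → ℝ)} (hF : F.IsFaceOf (COP K)) {v : Fin n → ℝ} :
    v ∈ dyadSpace hF ↔ dyad v ∈ F := Iff.rfl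

variable [NeZero n]

/-- Every element of a face is a sum of rank-one matrices in the face and a nonnegative multiple of
the Lorentz form in the face. -/
theorem exists_decomposition (hF : F.IsFaceOf (COP (secondOrderCone n))) {A : Sym n} (hA : A ∈ F) :
    ∃ (m : ℕ) (v : Fin m → Fin n → ℝ) (t : ℝ), (∀ i, v i ∈ dyadSpace hF) ∧ 0 ≤ t ∧
      (0 < t → lorentz n ∈ F) ∧ A = ∑ i, dyad (v i) + t • lorentz n := by
  obtain ⟨t, ht, hP⟩ := mem_COP_secondOrderCone_iff.1 (hF.le hA)
  have hsum : (A - t • lorentz n) + t • lorentz n ∈ F := by rwa [sub_add_cancel]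
  have hPC : A - t • lorentz n ∈ COP (secondOrderCone n) := mem_COP_of_qf_nonneg hP
  have htC : t • lorentz n ∈ COP (secondOrderCone n) :=
    (COP (secondOrderCone n)).smul_mem ht lorentz_mem_COP
  have hPF := hF.mem_of_add_mem_left hPC htC hsum
  have htF := hF.mem_of_add_mem_right hPC htC hsum
  obtain ⟨m, v, hv⟩ := exists_eq_sum_dyad hP
  refine ⟨m, v, t, fun i => ?_, ht, fun h => (smul_mem_iff_of_pos h).1 htF, ?_⟩
  · rw [hv] at hPF
    exact hF.mem_of_sum_mem (fun i => dyad_mem_COP (v i)) hPF i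
  · rw [← hv, sub_add_cancel]

theorem le_of_dyadSpace_le (hF : F.IsFaceOf (COP (secondOrderCone n)))
    (hG : G.IsFaceOf (COP (secondOrderCone n))) (hV : dyadSpace hF ≤ dyadSpace hG)
    (hJ : lorentz n ∈ F → lorentz n ∈ G) : F ≤ G := by
  intro A hA
  obtain ⟨m, v, t, hv, ht, htF, rfl⟩ := exists_decomposition hF hA
  refine G.add_mem (sum_mem fun i _ => hV (hv i)) ?_
  rcases ht.eq_or_lt with rfl | ht
  · rw [zero_smul]
    exact G.zero_mem
  · exact G.smul_mem ht.le (hJ (htF ht))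

open Classical in
/-- The rank of a face: the dimension of the space of its rank-one matrices, increased by one if the
face contains the Lorentz form. -/
def faceRank (hF : F.IsFaceOf (COP (secondOrderCone n))) : ℕ :=
  Module.finrank ℝ (dyadSpace hF) + if lorentz n ∈ F then 1 else 0

theorem faceRank_le (hF : F.IsFaceOf (COP (secondOrderCone n))) : faceRank hF ≤ n + 1 := by
  have h := Submodule.finrank_le (dyadSpace hF)
  rw [Module.finrank_fin_fun] at h
  rw [faceRank]
  split_ifs <;> omega

/-- Both summands of the rank are monotone; if neither grew, the two faces would have the same data
and coincide. -/
theorem faceRank_lt_of_lt (hF : F.IsFaceOf (COP (secondOrderCone n)))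
    (hG : G.IsFaceOf (COP (secondOrderCone n))) (hFG : F < G) : faceRank hF < faceRank hG := by
  have hV : dyadSpace hF ≤ dyadSpace hG := fun v hv => hFG.le hv
  have hdim := Submodule.finrank_mono hV
  by_contra hcon
  refine hFG.not_ge ?_
  rw [faceRank, faceRank] at hcon
  have hJ : lorentz n ∈ F → lorentz n ∈ G := fun h => hFG.le h
  refine le_of_dyadSpace_le hG hF (Submodule.eq_of_le_of_finrank_eq hV ?_).ge fun h => ?_
  · split_ifs at hcon with h1 h2 h2
    · omega
    · exact absurd (hJ h1) h2
    · omega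
    · omega
  · by_contra h'
    rw [if_pos h, if_neg h'] at hcon
    omega

/-- A face containing rank-one matrices for at most a line of vectors is polyhedral. -/
theorem isPolyhedral_of_finrank_le_one (hn : 1 < n) (hF : F.IsFaceOf (COP (secondOrderCone n)))
    (hdim : Module.finrank ℝ (dyadSpace hF) ≤ 1) : IsPolyhedral F := by
  classical
  obtain ⟨v, hv0, hv⟩ : ∃ v : Fin n → ℝ, v ≠ 0 ∧ ∀ w ∈ dyadSpace hF, ∃ c : ℝ, w = c • v := by
    obtain ⟨v, hv⟩ := finrank_le_one_iff.1 hdim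
    have hv' : ∀ w ∈ dyadSpace hF, ∃ c : ℝ, w = c • (v : Fin n → ℝ) := fun w hw => by
      obtain ⟨c, hc⟩ := hv ⟨w, hw⟩
      exact ⟨c, (congrArg Subtype.val hc).symm⟩
    by_cases h0 : (v : Fin n → ℝ) = 0
    -- If the space is zero, any nonzero vector serves; the generating family keeps only those
    -- matrices that lie in `F`.
    · refine ⟨Pi.single 0 1, by simp, fun w hw => ⟨0, ?_⟩⟩
      obtain ⟨c, rfl⟩ := hv' w hw
      rw [h0, smul_zero, zero_smul]
    · exact ⟨v, h0, hv'⟩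
  have hli := linearIndependent_dyad_lorentz hn hv0
  let g : {i : Fin 2 // ![dyad v, lorentz n] i ∈ F} → Sym n := fun i => ![dyad v, lorentz n] i
  refine isPolyhedral_of_linearIndependent (g := g) (hli.comp _ Subtype.val_injective) fun A => ?_
  constructor
  · intro hA
    obtain ⟨m, w, t, hw, ht, htF, rfl⟩ := exists_decomposition hF hA
    choose c hc using fun i => hv (w i) (hw i)
    have hsum : ∑ i, dyad (w i) = (∑ i, c i ^ 2) • dyad v := by
      rw [Finset.sum_smul]
      exact Finset.sum_congr rfl fun i _ => by rw [hc i, dyad_smul]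
    have hs : 0 ≤ ∑ i, c i ^ 2 := Finset.sum_nonneg fun i _ => sq_nonneg _
    have hsF : 0 < ∑ i, c i ^ 2 → dyad v ∈ F := fun h => by
      rw [← smul_mem_iff_of_pos h, ← hsum]
      exact sum_mem fun i _ => hw i
    refine ⟨fun i => ![∑ i, c i ^ 2, t] i, ?_, ?_⟩
    · rintro ⟨i, hi⟩
      fin_cases i
      exacts [hs, ht]
    · have hall : ∑ i : Fin 2, ![∑ i, c i ^ 2, t] i • ![dyad v, lorentz n] i
          = ∑ i, dyad (w i) + t • lorentz n := by
        rw [Fin.sum_univ_two, hsum]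
        rfl
      rw [← hall]
      rw [← Fintype.sum_subtype_add_sum_subtype (fun i => ![dyad v, lorentz n] i ∈ F)]
      refine add_eq_left.2 (Finset.sum_eq_zero ?_)
      rintro ⟨i, hi⟩ -
      suffices h : ![∑ i, c i ^ 2, t] i = 0 by simp only [h, zero_smul]
      fin_cases i
      · exact le_antisymm (not_lt.1 fun h => hi (hsF h)) hs
      · exact le_antisymm (not_lt.1 fun h => hi (htF h)) ht
  · rintro ⟨c, hc, rfl⟩
    exact sum_mem fun i _ => F.smul_mem (hc i) i.2

theorem length_add_one_le (hn : 1 < n) {k : ℕ} {F : Fin (k + 1) → PointedCone ℝ (Sym n)}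
    (hF : IsNonpolyhedralChain (COP (secondOrderCone n)) F) : k + 1 ≤ n := by
  have hanti : StrictAnti fun i => faceRank (hF.isFaceOf i) :=
    fun i j hij => faceRank_lt_of_lt _ _ (hF.strictAnti hij)
  have hlast : 2 ≤ faceRank (hF.isFaceOf (Fin.last k)) := by
    by_contra hcon
    refine hF.not_isPolyhedral (isPolyhedral_of_finrank_le_one hn (hF.isFaceOf _) ?_)
    rw [faceRank] at hcon
    omega
  have hle : ∀ i : Fin (k + 1), faceRank (hF.isFaceOf i) + i ≤ n + 1 := by
    intro i
    induction i using Fin.induction with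
    | zero => simpa using faceRank_le _
    | succ i ih =>
      have := hanti (Fin.castSucc_lt_succ (i := i))
      simp only [Fin.val_castSucc, Fin.val_succ] at ih this ⊢
      omega
  have := hle (Fin.last k)
  rw [Fin.val_last] at this
  omega

end Faces

/-! ### Faces defined by prescribed kernel vectors -/

section KernelFaces

variable {n : ℕ}

/-- The positive semidefinite matrices that annihilate all vectors of `W`. -/
def kerCone (W : Set (Fin n → ℝ)) : PointedCone ℝ (Sym n) where
  carrier := {A | (∀ x, 0 ≤ qf A x) ∧ ∀ w ∈ W, (A : Matrix (Fin n) (Fin n) ℝ) *ᵥ w = 0}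
  zero_mem' := ⟨fun x => by simp [qf], fun w _ => by simp⟩
  add_mem' := by
    rintro A B ⟨hA, hA'⟩ ⟨hB, hB'⟩
    refine ⟨fun x => ?_, fun w hw => ?_⟩
    · rw [qf_add]
      exact add_nonneg (hA x) (hB x)
    · rw [Submodule.coe_add, Matrix.add_mulVec, hA' w hw, hB' w hw, add_zero]
  smul_mem' := by
    rintro c A ⟨hA, hA'⟩
    have e : c • A = (c : ℝ) • A := rfl
    refine ⟨fun x => ?_, fun w hw => ?_⟩
    · rw [e, qf_smul]
      exact mul_nonneg c.2 (hA x)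
    · rw [e, Submodule.coe_smul, Matrix.smul_mulVec, hA' w hw, smul_zero]

theorem mem_kerCone {W : Set (Fin n → ℝ)} {A : Sym n} : A ∈ kerCone W ↔
    (∀ x, 0 ≤ qf A x) ∧ ∀ w ∈ W, (A : Matrix (Fin n) (Fin n) ℝ) *ᵥ w = 0 := Iff.rfl

theorem dyad_mem_kerCone_iff {W : Set (Fin n → ℝ)} {v : Fin n → ℝ} :
    dyad v ∈ kerCone W ↔ ∀ w ∈ W, v ⬝ᵥ w = 0 := by
  rw [mem_kerCone]
  constructor
  · intro h w hw
    have := qf_eq_zero_of_mulVec _ (h.2 w hw)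
    rwa [qf_dyad, sq_eq_zero_iff] at this
  · intro h
    refine ⟨fun x => by rw [qf_dyad]; positivity, fun w hw => ?_⟩
    rw [dyad_mulVec, h w hw, zero_smul]

variable [NeZero n]

/-- The sums of an element of `kerCone W` and a nonnegative multiple of the Lorentz form. -/
def kerConeAddLorentz (W : Set (Fin n → ℝ)) : PointedCone ℝ (Sym n) where
  carrier := {A | ∃ t : ℝ, 0 ≤ t ∧ A - t • lorentz n ∈ kerCone W}
  zero_mem' := ⟨0, le_rfl, by simp⟩
  add_mem' := by
    rintro A B ⟨s, hs, hA⟩ ⟨t, ht, hB⟩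
    refine ⟨s + t, add_nonneg hs ht, ?_⟩
    rw [add_smul, add_sub_add_comm]
    exact (kerCone W).add_mem hA hB
  smul_mem' := by
    rintro c A ⟨t, ht, hA⟩
    refine ⟨c * t, mul_nonneg c.2 ht, ?_⟩
    have e : c • A = (c : ℝ) • A := rfl
    rw [e, show (c : ℝ) • A - ((c : ℝ) * t) • lorentz n = (c : ℝ) • (A - t • lorentz n) by module]
    exact (kerCone W).smul_mem c.2 hA

variable {W : Set (Fin n → ℝ)} {u : Fin n → ℝ}

theorem kerConeAddLorentz_le : kerConeAddLorentz W ≤ COP (secondOrderCone n) := by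
  rintro A ⟨t, ht, hA⟩
  exact mem_COP_secondOrderCone_iff.2 ⟨t, ht, hA.1⟩

theorem kerCone_le_kerConeAddLorentz : kerCone W ≤ kerConeAddLorentz W := fun A hA =>
  ⟨0, le_rfl, by rwa [zero_smul, sub_zero]⟩

theorem lorentz_mulVec_ne_zero (hu : u ≠ 0) :
    (lorentz n : Matrix (Fin n) (Fin n) ℝ) *ᵥ u ≠ 0 := by
  obtain ⟨i, hi⟩ := Function.ne_iff.1 hu
  refine Function.ne_iff.2 ⟨i, ?_⟩
  rw [lorentz_mulVec]
  split_ifs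
  · exact hi
  · exact neg_ne_zero.2 hi

/-- If a positive combination of two copositive matrices annihilates a null vector up to a multiple
of the Lorentz form, then so do their positive semidefinite parts. -/
theorem sub_smul_lorentz_mem_kerCone (huW : u ∈ W) (hu : u ≠ 0) (hu0 : qf (lorentz n) u = 0)
    {A B : Sym n} {a r s t : ℝ} (ha : 0 < a) (hA : ∀ x, 0 ≤ qf (A - s • lorentz n) x)
    (hB : ∀ x, 0 ≤ qf (B - t • lorentz n) x) (hAB : a • A + B - r • lorentz n ∈ kerCone W) :
    r = a * s + t ∧ A - s • lorentz n ∈ kerCone W := by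
  -- At the null vector u the J-terms contribute nothing, so both semidefinite parts vanish at u and
  -- hence annihilate it. What remains is a multiple of J u ≠ 0, so its coefficient is zero.
  have hR := hAB.2 u huW
  have e : a • A + B - r • lorentz n = a • (A - s • lorentz n) + (B - t • lorentz n)
      + (a * s + t - r) • lorentz n := by module
  rw [e] at hAB hR
  have h0 := qf_eq_zero_of_mulVec _ hR
  rw [qf_add, qf_add, qf_smul, qf_smul, hu0, mul_zero, add_zero] at h0
  have hAu := mul_nonneg ha.le (hA u)
  have hA0 := mulVec_eq_zero_of_qf hA
    ((mul_eq_zero.1 (le_antisymm (by linarith [hB u]) hAu)).resolve_left ha.ne')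
  have hB0 := mulVec_eq_zero_of_qf hB (le_antisymm (by linarith) (hB u))
  rw [Submodule.coe_add, Submodule.coe_add, Submodule.coe_smul, Submodule.coe_smul,
    Matrix.add_mulVec, Matrix.add_mulVec, Matrix.smul_mulVec, Matrix.smul_mulVec, hA0, hB0,
    smul_zero, zero_add, zero_add, smul_eq_zero] at hR
  have hr := hR.resolve_right (lorentz_mulVec_ne_zero hu)
  rw [hr, zero_smul, add_zero] at hAB
  refine ⟨by linarith, hA, fun w hw => mulVec_eq_zero_of_qf hA ?_⟩
  have hw0 := qf_eq_zero_of_mulVec _ (hAB.2 w hw)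
  rw [qf_add, qf_smul] at hw0
  exact (mul_eq_zero.1 (le_antisymm (by linarith [hB w])
    (mul_nonneg ha.le (hA w)))).resolve_left ha.ne'

theorem isFaceOf_kerConeAddLorentz (huW : u ∈ W) (hu : u ≠ 0) (hu0 : qf (lorentz n) u = 0) :
    (kerConeAddLorentz W).IsFaceOf (COP (secondOrderCone n)) where
  le := kerConeAddLorentz_le
  mem_of_smul_add_mem := by
    rintro A B a hA hB ha ⟨r, hr, hAB⟩
    obtain ⟨s, hs, hA⟩ := mem_COP_secondOrderCone_iff.1 hA
    obtain ⟨t, ht, hB⟩ := mem_COP_secondOrderCone_iff.1 hB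
    exact ⟨s, hs, (sub_smul_lorentz_mem_kerCone huW hu hu0 ha hA hB hAB).2⟩

theorem isFaceOf_kerCone (huW : u ∈ W) (hu : u ≠ 0) (hu0 : qf (lorentz n) u = 0) :
    (kerCone W).IsFaceOf (COP (secondOrderCone n)) where
  le := kerCone_le_kerConeAddLorentz.trans kerConeAddLorentz_le
  mem_of_smul_add_mem := by
    intro A B a hA hB ha hAB
    obtain ⟨s, hs, hA⟩ := mem_COP_secondOrderCone_iff.1 hA
    obtain ⟨t, ht, hB⟩ := mem_COP_secondOrderCone_iff.1 hB
    have h := sub_smul_lorentz_mem_kerCone huW hu hu0 (r := 0) ha hA hB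
      (by rwa [zero_smul, sub_zero])
    have hs0 : s = 0 := by
      have := mul_nonneg ha.le hs
      exact (mul_eq_zero.1 (by linarith [h.1] : a * s = 0)).resolve_left ha.ne'
    have h2 := h.2
    rwa [hs0, zero_smul, sub_zero] at h2

theorem dyad_mem_kerConeAddLorentz_iff (huW : u ∈ W) (hu : u ≠ 0) {v : Fin n → ℝ}
    (hvu : v ⬝ᵥ u = 0) : dyad v ∈ kerConeAddLorentz W ↔ dyad v ∈ kerCone W := by
  refine ⟨?_, fun h => kerCone_le_kerConeAddLorentz h⟩
  rintro ⟨t, ht, h⟩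
  have h0 := h.2 u huW
  rw [Submodule.coe_sub, Submodule.coe_smul, Matrix.sub_mulVec, Matrix.smul_mulVec, dyad_mulVec,
    hvu, zero_smul, zero_sub, neg_eq_zero, smul_eq_zero] at h0
  rw [h0.resolve_right (lorentz_mulVec_ne_zero hu), zero_smul, sub_zero] at h
  exact h

/-- All members of the smaller cone have quadratic form zero at u, but u uᵀ does not. -/
theorem kerConeAddLorentz_lt (huW : u ∈ W) (hu : u ≠ 0) (hu0 : qf (lorentz n) u = 0) :
    kerConeAddLorentz W < COP (secondOrderCone n) := by
  refine lt_of_le_of_ne kerConeAddLorentz_le fun heq => ?_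
  obtain ⟨t, ht, h⟩ : dyad u ∈ kerConeAddLorentz W := heq ▸ dyad_mem_COP u
  have h0 := qf_eq_zero_of_mulVec _ (h.2 u huW)
  rw [qf_sub, qf_smul, hu0, mul_zero, sub_zero, qf_dyad, sq_eq_zero_iff, dotProduct_self_eq_zero]
    at h0
  exact hu h0

theorem kerCone_lt_kerConeAddLorentz (hn : 1 < n) : kerCone W < kerConeAddLorentz W := by
  refine lt_of_le_of_ne kerCone_le_kerConeAddLorentz fun heq => ?_
  have hJ : lorentz n ∈ kerConeAddLorentz W :=
    ⟨1, zero_le_one, by rw [one_smul, sub_self]; exact (kerCone W).zero_mem⟩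
  rw [← heq] at hJ
  have h := hJ.1 (Pi.single ⟨1, hn⟩ 1)
  have h10 : (⟨1, hn⟩ : Fin n) ≠ 0 := by
    intro h
    simpa using congrArg Fin.val h
  rw [qf, single_one_dotProduct, lorentz_mulVec, if_neg h10, Pi.single_eq_same] at h
  linarith

end KernelFaces

/-! ### A chain of faces of maximal length -/

section Chain

/-- The null vector `e₀ + e₁`. -/
def nullVec (m : ℕ) : Fin (m + 3) → ℝ := Pi.single 0 1 + Pi.single 1 1

/-- The null vector `e₀ + e₁` together with all `eⱼ`, `j > k`. -/
def chainSet (m k : ℕ) : Set (Fin (m + 3) → ℝ) :=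
  insert (nullVec m) {x | ∃ j : Fin (m + 3), k < j ∧ x = Pi.single j 1}

theorem nullVec_mem_chainSet (m k : ℕ) : nullVec m ∈ chainSet m k := Set.mem_insert _ _

theorem chainSet_anti (m k : ℕ) : chainSet m (k + 1) ⊆ chainSet m k :=
  Set.insert_subset_insert fun _ ⟨j, hj, hx⟩ => ⟨j, by omega, hx⟩

theorem nullVec_ne_zero (m : ℕ) : nullVec m ≠ 0 := by
  intro h
  simpa [nullVec] using congrFun h 0

theorem qf_lorentz_nullVec (m : ℕ) : qf (lorentz (m + 3)) (nullVec m) = 0 := by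
  rw [qf, nullVec, add_dotProduct, single_one_dotProduct, single_one_dotProduct, lorentz_mulVec,
    lorentz_mulVec]
  simp

theorem kerConeAddLorentz_chainSet_lt {m k : ℕ} (hk : 2 ≤ k) (hkm : k < m + 2) :
    kerConeAddLorentz (chainSet m k) < kerConeAddLorentz (chainSet m (k + 1)) := by
  refine lt_of_le_of_ne ?_ fun heq => ?_
  · rintro A ⟨t, ht, hA⟩
    exact ⟨t, ht, hA.1, fun w hw => hA.2 w (chainSet_anti m k hw)⟩
  · let j : Fin (m + 3) := ⟨k + 1, by omega⟩
    have hju : Pi.single j (1 : ℝ) ⬝ᵥ nullVec m = 0 := by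
      have h0 : j ≠ 0 := by simp [j, Fin.ext_iff]
      have h1 : j ≠ 1 := by simp [j, Fin.ext_iff]; omega
      simp [nullVec, h0, h1]
    have hmem : dyad (Pi.single j 1) ∈ kerConeAddLorentz (chainSet m (k + 1)) := by
      refine kerCone_le_kerConeAddLorentz (dyad_mem_kerCone_iff.2 ?_)
      rintro w (rfl | ⟨i, hi, rfl⟩)
      · exact hju
      · have hij : j ≠ i := by
          rintro rfl
          exact lt_irrefl _ hi
        simp [hij]
    rw [← heq, dyad_mem_kerConeAddLorentz_iff (nullVec_mem_chainSet m k) (nullVec_ne_zero m) hju,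
      dyad_mem_kerCone_iff] at hmem
    have := hmem (Pi.single j 1) (Or.inr ⟨j, Nat.lt_succ_self k, rfl⟩)
    simp at this

theorem not_isPolyhedral_kerCone_chainSet (m : ℕ) : ¬ IsPolyhedral (kerCone (chainSet m 2)) := by
  let a : Fin (m + 3) → ℝ := Pi.single 0 1 - Pi.single 1 1
  let b : Fin (m + 3) → ℝ := Pi.single 2 1
  have hval : ((2 : Fin (m + 3)) : ℕ) = 2 := Nat.mod_eq_of_lt (show 2 < m + 3 by omega)
  have h20 : (2 : Fin (m + 3)) ≠ 0 := by rw [Ne, Fin.ext_iff, hval]; simp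
  have h21 : (2 : Fin (m + 3)) ≠ 1 := by rw [Ne, Fin.ext_iff, hval]; simp
  refine not_isPolyhedral_of_parabola (p := dyad a) (q := dyad (a + b) - dyad a - dyad b)
    (r := dyad b) Set.infinite_univ (fun s _ => ?_) fun s _ ε hε hcon => ?_
  · rw [← dyad_add_smul, dyad_mem_kerCone_iff]
    rintro w (rfl | ⟨i, hi, rfl⟩)
    · simp [a, b, nullVec, h20, h21]
    · have h0 : i ≠ 0 := by rintro rfl; simp at hi
      have h1 : i ≠ 1 := by rintro rfl; simp at hi
      have h2 : i ≠ 2 := by rintro rfl; exact absurd hi (by rw [hval]; exact lt_irrefl 2)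
      simp [a, b, h0, h1, h2]
  · rw [← dyad_add_smul] at hcon
    -- This vector is orthogonal to a + s • b and has inner product 1 with b, so the form takes the
    -- value -ε.
    have h := hcon.1 (Pi.single 2 1 - s • Pi.single 0 1)
    rw [qf_sub, qf_smul, qf_dyad, qf_dyad] at h
    simp [a, b, h20, h21, h20.symm] at h
    linarith

/-- A chain of `m + 3` faces of the copositive cone over the second-order cone of dimension `m + 3`
with nonpolyhedral last member. -/
def faceChain (m : ℕ) (i : ℕ) : PointedCone ℝ (Sym (m + 3)) :=
  if i = 0 then COP (secondOrderCone (m + 3))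
  else if i = m + 2 then kerCone (chainSet m 2)
  -- For 1 ≤ i ≤ m + 1 the parameter falls from m + 2, where only the null vector is prescribed, to
  -- 2, where e₀ - e₁ and e₂ span the orthogonal complement.
  else kerConeAddLorentz (chainSet m (m + 3 - i))

theorem isNonpolyhedralChain_faceChain (m : ℕ) :
    IsNonpolyhedralChain (COP (secondOrderCone (m + 3)))
      (fun i : Fin (m + 2 + 1) => faceChain m i) where
  strictAnti := by
    rw [Fin.strictAnti_iff_succ_lt]
    rintro ⟨i, hi⟩
    simp only [faceChain, Fin.val_succ, Fin.val_castSucc, Nat.succ_ne_zero, if_false]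
    rcases Nat.eq_zero_or_pos i with rfl | h0
    · rw [if_pos rfl, if_neg (by omega)]
      exact kerConeAddLorentz_lt (nullVec_mem_chainSet _ _) (nullVec_ne_zero m)
        (qf_lorentz_nullVec m)
    · rw [if_neg h0.ne', if_neg (by omega : i ≠ m + 2)]
      by_cases h1 : i = m + 1
      · subst h1
        rw [if_pos rfl, show m + 3 - (m + 1) = 2 by omega]
        exact kerCone_lt_kerConeAddLorentz (by omega)
      · rw [if_neg (by omega), show m + 3 - i = m + 3 - (i + 1) + 1 by omega]
        exact kerConeAddLorentz_chainSet_lt (by omega) (by omega)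
  isFaceOf := by
    intro i
    simp only [faceChain]
    split_ifs
    · exact PointedCone.IsFaceOf.refl _
    · exact isFaceOf_kerCone (nullVec_mem_chainSet _ _) (nullVec_ne_zero m) (qf_lorentz_nullVec m)
    · exact isFaceOf_kerConeAddLorentz (nullVec_mem_chainSet _ _) (nullVec_ne_zero m)
        (qf_lorentz_nullVec m)
  not_isPolyhedral := by
    simp only [faceChain, Fin.val_last, if_neg (Nat.succ_ne_zero (m + 1)), if_true]
    exact not_isPolyhedral_kerCone_chainSet m

end Chain

/-! ### The two-dimensional case -/

section TwoDim

theorem not_isPolyhedral_COP_two : ¬ IsPolyhedral (COP (secondOrderCone 2)) := by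
  refine not_isPolyhedral_of_parabola (p := dyad ![0, -1])
    (q := dyad (![0, -1] + ![1, 0]) - dyad ![0, -1] - dyad ![1, 0]) (r := dyad ![1, 0])
    -- For s in [0, 1] the vector (1, s) lies in 𝕃². It is orthogonal to (s, -1) and has inner
    -- product 1 with (1, 0), so it detects the move by -ε.
    (Set.Icc_infinite zero_lt_one) (fun s _ => ?_) fun s hs ε hε hcon => ?_
  · rw [← dyad_add_smul]
    exact dyad_mem_COP _
  · rw [← dyad_add_smul] at hcon
    have hx : ![1, s] ∈ secondOrderCone 2 := by
      have he : Finset.univ.erase (0 : Fin 2) = {1} := by decide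
      simp only [secondOrderCone, Set.mem_ofPred_eq, he, Finset.sum_singleton]
      simpa [Real.sqrt_sq hs.1] using hs.2
    have h := mem_COP_iff_qf.1 hcon _ hx
    rw [qf_sub, qf_smul, qf_dyad, qf_dyad] at h
    simp [dotProduct, Fin.sum_univ_two] at h
    linarith

theorem eq_COP_of_not_isPolyhedral {F : PointedCone ℝ (Sym 2)}
    (hF : F.IsFaceOf (COP (secondOrderCone 2))) (h : ¬ IsPolyhedral F) :
    F = COP (secondOrderCone 2) := by
  have hdim : Module.finrank ℝ (dyadSpace hF) = 2 := by
    have h1 := Submodule.finrank_le (dyadSpace hF)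
    rw [Module.finrank_fin_fun] at h1
    have h2 := mt (isPolyhedral_of_finrank_le_one one_lt_two hF) h
    omega
  have htop : dyadSpace hF = ⊤ := Submodule.eq_top_of_finrank_eq (by rw [hdim]; simp)
  have hmem : ∀ v, dyad v ∈ F := fun v => by
    rw [← mem_dyadSpace hF, htop]
    trivial
  have hJ : lorentz 2 ∈ F := by
    refine hF.mem_of_add_mem_left lorentz_mem_COP
      (dyad_mem_COP (Pi.single 1 1 : Fin 2 → ℝ) |> (COP _).smul_mem (zero_le_two (α := ℝ))) ?_
    -- Both sides are the identity matrix, so J is a summand of an element of the face.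
    have e : lorentz 2 + (2 : ℝ) • dyad (Pi.single 1 1 : Fin 2 → ℝ)
        = dyad (Pi.single 0 1 : Fin 2 → ℝ) + dyad (Pi.single 1 1 : Fin 2 → ℝ) := by
      ext i j
      fin_cases i <;> fin_cases j <;> norm_num [dyad_apply, lorentz]
    rw [e]
    exact F.add_mem (hmem _) (hmem _)
  refine le_antisymm hF.le (le_of_dyadSpace_le (PointedCone.IsFaceOf.refl _) hF ?_ fun _ => hJ)
  rw [htop]
  exact le_top

end TwoDim

theorem distToPolyhedrality_COP_two : distToPolyhedrality (COP (secondOrderCone 2)) = 1 := by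
  refine le_antisymm (sSup_le ?_) (le_sSup ?_)
  · rintro _ ⟨k, F, hF, rfl⟩
    have hlast := eq_COP_of_not_isPolyhedral (hF.isFaceOf (Fin.last k)) hF.not_isPolyhedral
    rcases Nat.eq_zero_or_pos k with rfl | hk
    · simp
    · have hlt := hF.strictAnti (show (0 : Fin (k + 1)) < Fin.last k from hk)
      rw [hlast] at hlt
      exact absurd (hF.isFaceOf 0).le hlt.not_ge
  · refine ⟨0, fun _ => COP (secondOrderCone 2), ⟨?_, fun _ => PointedCone.IsFaceOf.refl _,
      not_isPolyhedral_COP_two⟩, by simp⟩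
    intro i j hij
    exact absurd hij (by omega)

theorem distToPolyhedrality_COP_add_three (m : ℕ) :
    distToPolyhedrality (COP (secondOrderCone (m + 3))) = ((m + 3 : ℕ) : ℕ∞) := by
  refine le_antisymm (sSup_le ?_) (le_sSup ?_)
  · rintro _ ⟨k, F, hF, rfl⟩
    exact_mod_cast length_add_one_le (by omega) hF
  · exact ⟨m + 2, _, isNonpolyhedralChain_faceChain m, by push_cast; ring⟩

end CopositiveSOC

end

theorem mainTheorem6 (n : ℕ) [NeZero n] :
    (n = 2 → CopositiveSOC.distToPolyhedrality
      (CopositiveSOC.COP (CopositiveSOC.secondOrderCone n)) = 1) ∧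
    (3 ≤ n → CopositiveSOC.distToPolyhedrality
      (CopositiveSOC.COP (CopositiveSOC.secondOrderCone n)) = (n : ℕ∞)) := by
  constructor
  · rintro rfl
    exact CopositiveSOC.distToPolyhedrality_COP_two
  · intro h
    obtain ⟨m, rfl⟩ := Nat.exists_eq_add_of_le' h
    exact CopositiveSOC.distToPolyhedrality_COP_add_three m
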